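/- Let $G$ be a finite simple undirected graph. Each edge $\{u,v\}$ is regarded as two directed edges $e=(u,v)$ and $e^{-1}=(v,u)$. An embedding of $G$ (in an orientable surface) is a choice, for every vertex $u$, of a cyclic order of all directed edges starting at $u$; write $\mathrm{nx}(e)$ for the directed edge following $e$ in the cyclic order at the starting point of $e$. The mirror image of an embedding is obtained by reversing all cyclic orders. The faces of an embedding are the directed cyclic walks $e_0,\dots,e_{n-1}$ with $\mathrm{nx}(e_i^{-1})=e_{(i+1)\bmod n}$ for $0\le i<n$, that is, the cycles of the permutation $e\mapsto \mathrm{nx}(e^{-1})$ of the directed edges. The genus of an embedding with $v$ vertices, $e$ undirected edges and $f$ faces is $\frac{2-(v-e+f)}{2}$. The embedding is polyhedral if every facial walk is a simple cycle and the intersection of any two distinct faces, viewed as subgraphs of $G$, is empty, a single vertex, or a single edge together with its two endpoints. A connected graph is planar if it has an embedding of genus $0$. The graph $G$ is 3-connected if it has more than three vertices and remains connected whenever fewer than three vertices are deleted. Theorem. Every 3-connected planar graph $G$ has, up to taking the mirror image, exactly one polyhedral embedding in an orientable surface (of any genus): there is a polyhedral embedding of $G$, and every polyhedral embedding of $G$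 is equal to it or to its mirror image. -/

import Mathlib

namespace SimpleGraph

variable {V : Type*}

/-- An embedding of `G` in an oriented surface, given combinatorially: `nx` sends a directed edge
`e` to the next one in the cyclic order around the starting point of `e`. All directed edges with
the same starting point lie on one cycle of `nx`, so `nx` is a cyclic order at every vertex. -/
@[ext]
structure RotationSystem (G : SimpleGraph V) where
  /-- the next directed edge around the same starting point -/
  nx : Equiv.Perm G.Dart
  fst_nx : ∀ e, (nx e).fst = e.fst
  sameCycle : ∀ e e' : G.Dart, e.fst = e'.fst → nx.SameCycle e e'

namespace RotationSystem

variable {G : SimpleGraph V}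

/-- The mirror image: all cyclic orders are reversed. -/
def mirror (R : G.RotationSystem) : G.RotationSystem where
  nx := R.nx⁻¹
  fst_nx e := by
    have h := R.fst_nx (R.nx⁻¹ e)
    rw [← Equiv.Perm.mul_apply, mul_inv_cancel, Equiv.Perm.one_apply] at h
    exact h.symm
  sameCycle e e' h := (R.sameCycle e e' h).inv

/-- Two embeddings are equivalent if they agree or are mirror images of each other. -/
def Equivalent (R R' : G.RotationSystem) : Prop :=
  R' = R ∨ R' = R.mirror

/-- The successor of a directed edge on its facial walk: `e ↦ nx (e⁻¹)`. -/
def facePerm (R : G.RotationSystem) : Equiv.Perm G.Dart :=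
  (Function.Involutive.toPerm Dart.symm Dart.symm_involutive).trans R.nx

/-- The face through the directed edge `e`: the set of the directed edges on its facial walk.
The facial walk is recovered from this set by applying `R.facePerm`. -/
def face (R : G.RotationSystem) (e : G.Dart) : Set G.Dart :=
  {e' | R.facePerm.SameCycle e e'}

/-- The set of all faces. -/
def faces (R : G.RotationSystem) : Set (Set G.Dart) :=
  Set.range R.face

/-- The genus, by the Euler formula. -/
noncomputable def genus (R : G.RotationSystem) : ℚ :=
  (2 - ((Nat.card V : ℚ) - (G.edgeSet.ncard : ℚ) + (R.faces.ncard : ℚ))) / 2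

end RotationSystem

/-- The subgraph of `G` formed by the edges underlying a set of directed edges, together with
their end points. -/
def dartSubgraph (G : SimpleGraph V) (F : Set G.Dart) : G.Subgraph where
  verts := {v | ∃ e ∈ F, v ∈ e.edge}
  Adj u v := ∃ e ∈ F, e.edge = s(u, v)
  adj_sub := by
    rintro u v ⟨e, -, h⟩
    have h' := e.edge_mem
    rw [h] at h'
    exact h'
  edge_vert := by
    rintro u v ⟨e, he, h⟩
    exact ⟨e, he, by rw [h]; exact Sym2.mem_mk_left u v⟩
  symm := ⟨by
    rintro u v ⟨e, he, h⟩
    exact ⟨e, he, h.trans Sym2.eq_swap⟩⟩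

namespace RotationSystem

variable {G : SimpleGraph V}

/-- Polyhedral embeddings: each facial walk is a simple cycle (it repeats neither a vertex nor an
undirected edge), and any two distinct faces, viewed as subgraphs of `G`, intersect in the empty
graph, in a single vertex, or in a single edge with its end points. -/
structure IsPolyhedral (R : G.RotationSystem) : Prop where
  vertex_simple : ∀ F ∈ R.faces, Set.InjOn (fun e : G.Dart => e.fst) F
  edge_simple : ∀ F ∈ R.faces, Set.InjOn (fun e : G.Dart => e.edge) F
  inter : ∀ F ∈ R.faces, ∀ F' ∈ R.faces, F ≠ F' →
    G.dartSubgraph F ⊓ G.dartSubgraph F' = ⊥ ∨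
    (∃ v, G.dartSubgraph F ⊓ G.dartSubgraph F' = G.singletonSubgraph v) ∨
    (∃ (u v : V) (h : G.Adj u v),
      G.dartSubgraph F ⊓ G.dartSubgraph F' = G.subgraphOfAdj h)

end RotationSystem

/-- A graph is planar if it has an embedding of genus `0`. (This is the definition for finite
connected graphs.) -/
def IsPlanar (G : SimpleGraph V) : Prop :=
  ∃ R : G.RotationSystem, R.genus = 0

/-- A finite graph is 3-connected if it has more than three vertices and stays connected whenever
fewer than three vertices are deleted. -/
def IsThreeConnected (G : SimpleGraph V) : Prop :=
  3 < Nat.card V ∧ ∀ S : Set V, S.ncard < 3 → (G.induce Sᶜ).Connected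

end SimpleGraph

/-!
The embedding is a planar one, and both halves of the theorem rest on the homology of the sphere.

Modulo 2, vertex coboundaries and face boundaries are orthogonal subspaces of the edge chains. As
the graph is connected, they have dimensions `v - 1` and `f - 1`, and genus zero says that these add
up to `e`. So each of them is the orthogonal complement of the other: an edge cochain that vanishes
on all face boundaries is a vertex coboundary (`exists_vertex_potential`), and a cycle is the
boundary of a chain of faces (`exists_face_potential`), which is the Jordan curve theorem.

*Planar embeddings are polyhedral* (`isPolyhedral_of_genus_eq_zero`). If a face passes through a
vertex twice, then the edges between the two corners form a cochain that vanishes on all face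
boundaries. The vertex function of which it is the coboundary shows that the vertex separates the
graph. In the same way, two faces with two common vertices give a closed curve through these faces
and vertices, which can cut off nothing but an edge between the two vertices
(`exists_dart_of_common_vertices`). With three common vertices, a vertex would have only two edges.

*Polyhedral embeddings agree with planar ones up to mirror image* (`IsPolyhedral.equivalent`). A
face of a polyhedral embedding, of whatever genus, is an induced cycle that does not separate the
graph (`mem_or_symm_mem_face`, `eq_of_forall_adj_off_face`): the other faces that meet it, taken in
the order around it, form a connected ring. In the planar embedding this cycle has two sides. All
the rest of the graph lies on one of them, so the other one is a single face, with the same or the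
opposite orientation (`face_agrees_or_opposes`). Hence at each corner the two rotations agree or are
inverse to each other. Both cannot occur, since each vertex has at least three edges, and the
choice spreads around vertices and along faces to the whole graph.
-/

/-! ### Cycles of permutations and dimension counts -/

namespace Equiv.Perm

/-- Induction along a cycle of a permutation of a finite type. -/
theorem SameCycle.forward_induction {α : Type*} [Finite α] {σ : Perm α} {x y : α}
    (h : σ.SameCycle x y) {p : α → Prop} (base : p x)
    (step : ∀ z, σ.SameCycle x z → p z → p (σ z)) : p y := by
  obtain ⟨n, rfl⟩ := h.exists_nat_pow_eq
  clear h
  induction n with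
  | zero => exact base
  | succ n ih =>
    rw [pow_succ', mul_apply]
    exact step _ ⟨n, by simp⟩ ih

/-- A function on a cycle that is preserved by all steps but possibly one is preserved by all
steps, since the other steps lead back to the starting point of the exceptional one. -/
theorem apply_eq_of_forall_ne {α β : Type*} [Finite α] (σ : Perm α) (h : α → β) (x : α)
    (hx : ∀ z, σ.SameCycle x z → z ≠ x → h (σ z) = h z) : h (σ x) = h x := by
  have hc : σ.SameCycle (σ x) x := sameCycle_apply_left.2 (SameCycle.refl σ x)
  refine (hc.forward_induction (p := fun z => h z = h (σ x)) rfl fun z hz hp => ?_).symm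
  by_cases hzx : z = x
  · rw [hzx]
  · rw [hx z (sameCycle_apply_left.1 hz) hzx, hp]

/-- Modulo 2, the difference of two points of a cycle is the boundary of an arc of the cycle. -/
theorem SameCycle.exists_arc {α : Type*} [Finite α] [DecidableEq α] {σ : Perm α} {x y : α}
    (h : σ.SameCycle x y) : ∃ a : α → ZMod 2, (∀ z, a z ≠ 0 → σ.SameCycle x z) ∧
      ∀ z, a (σ z) + a z = (if σ z = x then 1 else 0) + (if σ z = y then 1 else 0) := by
  refine h.forward_induction (p := fun y => ∃ a : α → ZMod 2,
    (∀ z, a z ≠ 0 → σ.SameCycle x z) ∧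
    ∀ z, a (σ z) + a z = (if σ z = x then 1 else 0) + (if σ z = y then 1 else 0)) ?_ ?_
  · exact ⟨0, by simp, fun z => by simp [CharTwo.add_self_eq_zero]⟩
  · rintro y hy ⟨a, ha, hb⟩
    refine ⟨fun z => a z + if z = y then 1 else 0, fun z hz => ?_, fun z => ?_⟩
    · by_cases hzy : z = y
      · exact hzy ▸ hy
      · exact ha z (by simpa [hzy] using hz)
    · have h1 : a (σ z) = a z + ((if σ z = x then 1 else 0) + (if σ z = y then 1 else 0)) := by
        rw [← hb z, add_comm (a (σ z)), ← add_assoc, CharTwo.add_self_eq_zero, zero_add]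
      simp only [EmbeddingLike.apply_eq_iff_eq, h1]
      generalize (if σ z = x then (1 : ZMod 2) else 0) = p
      generalize (if σ z = y then (1 : ZMod 2) else 0) = q
      generalize (if z = y then (1 : ZMod 2) else 0) = r
      generalize a z = s
      revert p q r s
      decide

end Equiv.Perm

/-- If the ranges of two linear maps into `E → K` are orthogonal and their dimensions add up to
at least that of `E → K`, then each range is the full orthogonal complement of the other. -/
theorem LinearMap.exists_eq_of_dotProduct_eq_zero {K E M N : Type*} [Field K] [Fintype E]
    [AddCommGroup M] [Module K M] [AddCommGroup N] [Module K N]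
    (f : M →ₗ[K] E → K) (g : N →ₗ[K] E → K) (hfg : ∀ a b, f a ⬝ᵥ g b = 0)
    (hdim : Fintype.card E ≤ Module.finrank K (range f) + Module.finrank K (range g))
    (x : E → K) (hx : ∀ a, f a ⬝ᵥ x = 0) : ∃ b, g b = x := by
  classical
  let B : LinearMap.BilinForm K (E → K) := Matrix.toBilin' 1
  have hB : ∀ y z, B y z = y ⬝ᵥ z := fun y z => by simp [B, Matrix.toBilin'_apply']
  have hnd : B.Nondegenerate :=
    LinearMap.BilinForm.nondegenerate_toBilin'_of_det_ne_zero' 1 (by simp)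
  have hle : range g ≤ B.orthogonal (range f) := by
    rintro _ ⟨b, rfl⟩ _ ⟨a, rfl⟩
    exact (hB _ _).trans (hfg a b)
  have heq : range g = B.orthogonal (range f) := by
    refine Submodule.eq_of_le_of_finrank_le hle ?_
    rw [LinearMap.BilinForm.finrank_orthogonal hnd, Module.finrank_fintype_fun_eq_card]
    lia
  have hmem : x ∈ B.orthogonal (range f) := by
    rintro _ ⟨a, rfl⟩
    exact (hB _ _).trans (hx a)
  rwa [← heq] at hmem

/-- A linear map on `A → K` whose kernel consists of constant functions has corank at most one. -/
theorem LinearMap.card_le_finrank_range_add_one {K A N : Type*} [Field K] [Fintype A]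
    [AddCommGroup N] [Module K N] (f : (A → K) →ₗ[K] N)
    (hf : ∀ x, f x = 0 → ∀ a b, x a = x b) :
    Fintype.card A ≤ Module.finrank K (range f) + 1 := by
  have hker : ker f ≤ Submodule.span K {1} := by
    intro x hx
    rw [Submodule.mem_span_singleton]
    rcases isEmpty_or_nonempty A with _ | ⟨⟨a⟩⟩
    · exact ⟨0, Subsingleton.elim _ _⟩
    · exact ⟨x a, funext fun b => by simpa using hf x hx a b⟩
  have h1 := Submodule.finrank_mono hker
  have h2 : Module.finrank K (Submodule.span K {(1 : A → K)}) ≤ 1 := by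
    simpa using finrank_span_le_card (R := K) {(1 : A → K)}
  have h3 := f.finrank_range_add_finrank_ker
  rw [Module.finrank_fintype_fun_eq_card] at h3
  lia

/-! ### Homology modulo 2 of an embedding -/

namespace SimpleGraph

variable {V : Type*} {G : SimpleGraph V}

instance Dart.instFinite [Finite V] : Finite G.Dart :=
  Finite.of_injective _ Dart.toProd_injective

/-- The edge chain with coefficients modulo 2 that a chain of directed edges induces. -/
noncomputable def edgeChain [Fintype G.Dart] [DecidableEq V] :
    (G.Dart → ZMod 2) →ₗ[ZMod 2] G.edgeSet → ZMod 2 where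
  toFun a e := ∑ d : G.Dart with d.edge = (e : Sym2 V), a d
  map_add' a b := funext fun e => by simp [Finset.sum_add_distrib]
  map_smul' c a := funext fun e => by simp [Finset.mul_sum]

theorem edgeChain_edge [Fintype G.Dart] [DecidableEq V] (a : G.Dart → ZMod 2) (d : G.Dart) :
    edgeChain a ⟨d.edge, d.edge_mem⟩ = a d + a d.symm := by
  have h : (Finset.univ.filter fun d' : G.Dart => d'.edge = d.edge) = {d, d.symm} := by
    ext d'
    simp [dart_edge_eq_iff]
  change ∑ d' : G.Dart with d'.edge = d.edge, a d' = _
  rw [h, Finset.sum_pair d.symm_ne.symm]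

theorem edgeChain_dotProduct [Fintype G.Dart] [DecidableEq V] [Fintype G.edgeSet]
    (a b : G.Dart → ZMod 2) :
    edgeChain a ⬝ᵥ edgeChain b = ∑ d, a d * (b d + b d.symm) := by
  have hs := Finset.sum_fiberwise (Finset.univ : Finset G.Dart)
    (fun d => (⟨d.edge, d.edge_mem⟩ : G.edgeSet)) (fun d => a d * (b d + b d.symm))
  rw [← hs, dotProduct]
  refine Finset.sum_congr rfl fun e _ => ?_
  change (∑ d : G.Dart with d.edge = (e : Sym2 V), a d) * _ = _
  rw [Finset.sum_mul]
  refine Finset.sum_congr (by ext; simp [Subtype.ext_iff]) fun d hd => ?_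
  rw [← (Finset.mem_filter.1 hd).2, edgeChain_edge]

namespace RotationSystem

variable (R : G.RotationSystem)

@[simp]
theorem facePerm_apply (d : G.Dart) : R.facePerm d = R.nx d.symm := rfl

theorem nx_eq_facePerm_symm (d : G.Dart) : R.nx d = R.facePerm d.symm := by simp

theorem fst_facePerm (d : G.Dart) : (R.facePerm d).fst = d.snd := R.fst_nx _

theorem mem_face_self (d : G.Dart) : d ∈ R.face d := Equiv.Perm.SameCycle.refl _ _

theorem face_eq_of_mem {d d' : G.Dart} (h : d' ∈ R.face d) : R.face d' = R.face d :=
  Set.ext fun _ => ⟨fun h' => Equiv.Perm.SameCycle.trans h h',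
    fun h' => Equiv.Perm.SameCycle.trans (Equiv.Perm.SameCycle.symm h) h'⟩

theorem face_facePerm (d : G.Dart) : R.face (R.facePerm d) = R.face d :=
  R.face_eq_of_mem (Equiv.Perm.sameCycle_apply_right.2 (Equiv.Perm.SameCycle.refl _ _))

theorem face_nx (d : G.Dart) : R.face (R.nx d) = R.face d.symm := by
  rw [nx_eq_facePerm_symm, face_facePerm]

theorem facePerm_mem_face {d d' : G.Dart} (h : d' ∈ R.face d) : R.facePerm d' ∈ R.face d :=
  Equiv.Perm.sameCycle_apply_right.2 h

theorem facePerm_mem_face_iff {d d' : G.Dart} : R.facePerm d' ∈ R.face d ↔ d' ∈ R.face d :=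
  Equiv.Perm.sameCycle_apply_right

variable {R}

/-- In a connected graph, the rotation and the reversal act transitively on directed edges. -/
theorem eq_of_invariant [Finite V] (hG : G.Preconnected) {α : Type*} {h : G.Dart → α}
    (hnx : ∀ d, h (R.nx d) = h d) (hsymm : ∀ d, h d.symm = h d) (d d' : G.Dart) : h d = h d' := by
  have hv : ∀ e e' : G.Dart, e.fst = e'.fst → h e = h e' := fun e e' hee =>
    (R.sameCycle e e' hee).forward_induction (p := fun z => h e = h z) rfl
      fun z _ hz => hz.trans (hnx z).symm
  suffices H : ∀ u v : V, G.Walk u v → ∀ e e' : G.Dart, e.fst = u → e'.fst = v → h e = h e' from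
    H _ _ (hG d.fst d'.fst).some d d' rfl rfl
  intro u v w
  induction w with
  | nil => exact fun e e' he he' => hv e e' (he.trans he'.symm)
  | @cons u w v hadj _ ih =>
    intro e e' he he'
    rw [hv e ⟨(u, w), hadj⟩ he, ← hsymm ⟨(u, w), hadj⟩]
    exact ih _ e' rfl he'

theorem eq_of_forall_adj (hG : G.Preconnected) {α : Type*} {g : V → α}
    (hg : ∀ u v, G.Adj u v → g u = g v) (u v : V) : g u = g v := by
  obtain ⟨w⟩ := hG u v
  induction w with
  | nil => rfl
  | cons hadj _ ih => exact (hg _ _ hadj).trans ih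

/-- The coboundary of a vertex cochain, modulo 2. -/
noncomputable def vertexCoboundary (G : SimpleGraph V) [Fintype G.Dart] [DecidableEq V] :
    (V → ZMod 2) →ₗ[ZMod 2] G.edgeSet → ZMod 2 :=
  edgeChain ∘ₗ LinearMap.funLeft (ZMod 2) (ZMod 2) fun d : G.Dart => d.fst

/-- The boundary of a chain of faces, modulo 2. -/
noncomputable def faceBoundary (R : G.RotationSystem) [Fintype G.Dart] [DecidableEq V] :
    (R.faces → ZMod 2) →ₗ[ZMod 2] G.edgeSet → ZMod 2 :=
  edgeChain ∘ₗ LinearMap.funLeft (ZMod 2) (ZMod 2) fun d : G.Dart => ⟨R.face d, d, rfl⟩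

theorem vertexCoboundary_edge [Fintype G.Dart] [DecidableEq V] (g : V → ZMod 2) (d : G.Dart) :
    vertexCoboundary G g ⟨d.edge, d.edge_mem⟩ = g d.fst + g d.snd :=
  edgeChain_edge _ d

theorem faceBoundary_edge [Fintype G.Dart] [DecidableEq V] (f : R.faces → ZMod 2) (d : G.Dart) :
    R.faceBoundary f ⟨d.edge, d.edge_mem⟩ =
      f ⟨R.face d, d, rfl⟩ + f ⟨R.face d.symm, d.symm, rfl⟩ :=
  edgeChain_edge _ d

/-- The boundary of a chain of faces is a cycle: by the rotation at a vertex, the two sides of the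
edges at that vertex pair up. -/
theorem sum_fst_mul_add_symm [Fintype G.Dart] (g : V → ZMod 2) {h : G.Dart → ZMod 2}
    (hh : ∀ d, h (R.facePerm d) = h d) : ∑ d : G.Dart, g d.fst * (h d + h d.symm) = 0 := by
  have h1 : ∑ d : G.Dart, g d.fst * h d.symm = ∑ d : G.Dart, g d.fst * h d := by
    rw [← Equiv.sum_comp R.nx fun d : G.Dart => g d.fst * h d]
    refine Finset.sum_congr rfl fun d _ => ?_
    rw [R.fst_nx, nx_eq_facePerm_symm, hh]
  simp only [mul_add, Finset.sum_add_distrib, h1, CharTwo.add_self_eq_zero]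

theorem vertexCoboundary_dotProduct_faceBoundary [Fintype G.Dart] [DecidableEq V]
    [Fintype G.edgeSet] (g : V → ZMod 2) (f : R.faces → ZMod 2) :
    vertexCoboundary G g ⬝ᵥ R.faceBoundary f = 0 := by
  refine (edgeChain_dotProduct _ _).trans (sum_fst_mul_add_symm (R := R) g fun d => ?_)
  simp only [LinearMap.funLeft_apply, face_facePerm]

/-- Euler's formula in terms of dimensions: in genus zero, vertex coboundaries and face boundaries
together have at least the dimension of the space of edge chains. -/
theorem card_edgeSet_le_of_genus_eq_zero [Finite V] (hG : G.Preconnected) (hR : R.genus = 0)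
    [Fintype G.Dart] [DecidableEq V] [Fintype G.edgeSet] :
    Fintype.card G.edgeSet ≤ Module.finrank (ZMod 2) (LinearMap.range (vertexCoboundary G)) +
      Module.finrank (ZMod 2) (LinearMap.range R.faceBoundary) := by
  have := Fintype.ofFinite V
  have := Fintype.ofFinite R.faces
  have hV := (vertexCoboundary G).card_le_finrank_range_add_one fun g hg =>
    eq_of_forall_adj hG fun u v huv => by
      have h := vertexCoboundary_edge g ⟨(u, v), huv⟩
      rw [hg] at h
      exact CharTwo.add_eq_zero.1 h.symm
  have hF := R.faceBoundary.card_le_finrank_range_add_one fun f hf => by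
    have hsymm : ∀ d : G.Dart, f ⟨R.face d.symm, d.symm, rfl⟩ = f ⟨R.face d, d, rfl⟩ := by
      intro d
      have h := faceBoundary_edge f d
      rw [hf] at h
      exact (CharTwo.add_eq_zero.1 h.symm).symm
    rintro ⟨_, d, rfl⟩ ⟨_, d', rfl⟩
    refine eq_of_invariant (R := R) hG (h := fun d => f ⟨R.face d, d, rfl⟩) (fun d => ?_) hsymm d d'
    simp only [face_nx, hsymm]
  simp only [genus, ← Nat.card_coe_set_eq, Nat.card_eq_fintype_card] at hR
  have hE : (Fintype.card V : ℚ) + Fintype.card R.faces = Fintype.card G.edgeSet + 2 := by linarith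
  have hE' : Fintype.card V + Fintype.card R.faces = Fintype.card G.edgeSet + 2 := by
    exact_mod_cast hE
  lia

/-- On the sphere, an edge cochain that vanishes on all face boundaries is a coboundary. -/
theorem exists_vertex_potential [Finite V] (hG : G.Preconnected) (hR : R.genus = 0)
    [Fintype G.Dart] (a : G.Dart → ZMod 2)
    (ha : ∀ h : G.Dart → ZMod 2, (∀ d, h (R.facePerm d) = h d) →
      ∑ d : G.Dart, a d * (h d + h d.symm) = 0) :
    ∃ g : V → ZMod 2, ∀ d : G.Dart, a d + a d.symm = g d.fst + g d.snd := by
  classical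
  have := Fintype.ofFinite G.edgeSet
  obtain ⟨g, hg⟩ := LinearMap.exists_eq_of_dotProduct_eq_zero R.faceBoundary (vertexCoboundary G)
    (fun f g => by rw [dotProduct_comm, vertexCoboundary_dotProduct_faceBoundary])
    (by rw [add_comm]; exact card_edgeSet_le_of_genus_eq_zero hG hR) (edgeChain a) fun f => by
      rw [dotProduct_comm]
      refine (edgeChain_dotProduct _ _).trans (ha _ fun d => ?_)
      simp only [LinearMap.funLeft_apply, face_facePerm]
  exact ⟨g, fun d => by rw [← edgeChain_edge, ← hg, vertexCoboundary_edge]⟩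

/-- On the sphere, a cycle is the boundary of a chain of faces. -/
theorem exists_face_potential [Finite V] (hG : G.Preconnected) (hR : R.genus = 0)
    [Fintype G.Dart] (a : G.Dart → ZMod 2)
    (ha : ∀ g : V → ZMod 2, ∑ d : G.Dart, a d * (g d.fst + g d.snd) = 0) :
    ∃ h : G.Dart → ZMod 2, (∀ d, h (R.facePerm d) = h d) ∧
      ∀ d : G.Dart, a d + a d.symm = h d + h d.symm := by
  classical
  have := Fintype.ofFinite G.edgeSet
  obtain ⟨f, hf⟩ := LinearMap.exists_eq_of_dotProduct_eq_zero (vertexCoboundary G) R.faceBoundary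
    vertexCoboundary_dotProduct_faceBoundary (card_edgeSet_le_of_genus_eq_zero hG hR)
    (edgeChain a) fun g => by
      rw [dotProduct_comm]
      exact (edgeChain_dotProduct _ _).trans (ha g)
  refine ⟨fun d => f ⟨R.face d, d, rfl⟩, fun d => ?_, fun d => ?_⟩
  · simp only [face_facePerm]
  · rw [← edgeChain_edge, ← hf, faceBoundary_edge]

end RotationSystem

end SimpleGraph

/-! ### Planar embeddings of 3-connected graphs -/

namespace SimpleGraph

variable {V : Type*} {G : SimpleGraph V}

theorem eq_of_forall_adj_off {S : Set V} (hS : (G.induce Sᶜ).Preconnected) {α : Type*} {g : V → α}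
    (hg : ∀ u v, u ∉ S → v ∉ S → G.Adj u v → g u = g v) {u v : V} (hu : u ∉ S) (hv : v ∉ S) :
    g u = g v :=
  RotationSystem.eq_of_forall_adj hS (g := fun w : ↥Sᶜ => g w)
    (fun u v huv => hg u v u.2 v.2 huv) ⟨u, hu⟩ ⟨v, hv⟩

theorem IsThreeConnected.preconnected (h3 : G.IsThreeConnected) : G.Preconnected := by
  intro u v
  have h := (h3.2 ∅ (by simp)).preconnected ⟨u, by simp⟩ ⟨v, by simp⟩
  exact h.map (Embedding.induce _).toHom

/-- Every vertex of a 3-connected graph has at least three neighbours. -/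
theorem IsThreeConnected.exists_adj_ne [Finite V] (h3 : G.IsThreeConnected) (v a b : V) :
    ∃ w, G.Adj v w ∧ w ≠ a ∧ w ≠ b := by
  have hab : ({a, b} : Set V).ncard ≤ 2 := (Set.ncard_insert_le a {b}).trans (by simp)
  have hS : (({a, b} : Set V) \ {v}).ncard < 3 :=
    (Set.ncard_le_ncard Set.sdiff_subset).trans_lt (by lia)
  have hc := (h3.2 _ hS).preconnected
  obtain ⟨z, hz⟩ : ∃ z, z ∉ insert v ({a, b} : Set V) := by
    by_contra! h
    have h1 := Set.ncard_insert_le v ({a, b} : Set V)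
    rw [Set.eq_univ_of_forall h, Set.ncard_univ] at h1
    have := h3.1
    lia
  have : Nontrivial ↥(({a, b} : Set V) \ {v})ᶜ :=
    ⟨⟨v, by simp⟩, ⟨z, fun h => hz (Or.inr h.1)⟩, fun h => hz (Or.inl (Subtype.ext_iff.1 h).symm)⟩
  obtain ⟨⟨w, hw⟩, hadj⟩ := hc.exists_adj_of_nontrivial ⟨v, by simp⟩
  have hvw : G.Adj v w := hadj
  refine ⟨w, hvw, ?_, ?_⟩ <;> rintro rfl <;> exact hw ⟨by simp, hvw.ne'⟩

namespace RotationSystem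

variable {R : G.RotationSystem}

theorem fst_eq_of_sameCycle [Finite V] {d d' : G.Dart} (h : R.nx.SameCycle d d') :
    d'.fst = d.fst :=
  h.forward_induction (p := fun z => z.fst = d.fst) rfl fun z _ hz => (R.fst_nx z).trans hz

theorem eq_of_face_eq [Finite V] {α : Type*} {h : G.Dart → α} (hh : ∀ d, h (R.facePerm d) = h d)
    {d d' : G.Dart} (hd : R.face d = R.face d') : h d = h d' := by
  have hm : R.facePerm.SameCycle d d' := by
    change d' ∈ R.face d
    rw [hd]
    exact R.mem_face_self d'
  exact hm.forward_induction (p := fun z => h d = h z) rfl fun z _ hz => hz.trans (hh z).symm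

/-- A rotation that returns after two steps would leave room for only two edges at its vertex. -/
theorem nx_nx_ne [Finite V] (h3 : G.IsThreeConnected) (d : G.Dart) : R.nx (R.nx d) ≠ d := by
  intro h
  obtain ⟨w, hw, h1, h2⟩ := h3.exists_adj_ne d.fst d.snd (R.nx d).snd
  have key : (⟨(d.fst, w), hw⟩ : G.Dart) = d ∨ (⟨(d.fst, w), hw⟩ : G.Dart) = R.nx d := by
    refine (R.sameCycle d ⟨(d.fst, w), hw⟩ rfl).forward_induction
      (p := fun z => z = d ∨ z = R.nx d) (Or.inl rfl) ?_
    rintro z - (rfl | rfl)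
    · exact Or.inr rfl
    · exact Or.inl h
  rcases key with key | key
  · exact h1 (congrArg (fun e : G.Dart => e.snd) key)
  · exact h2 (congrArg (fun e : G.Dart => e.snd) key)

theorem nx_ne [Finite V] (h3 : G.IsThreeConnected) (d : G.Dart) : R.nx d ≠ d := fun h =>
  R.nx_nx_ne h3 d (by rw [h, h])

/-- The edges in an arc of the rotation cross the faces at the two ends of the arc. -/
theorem sum_arc_mul [Fintype G.Dart] [DecidableEq G.Dart] {a : G.Dart → ZMod 2} {d₁ d₂ : G.Dart}
    (ha : ∀ z, a (R.nx z) + a z = (if R.nx z = d₁ then 1 else 0) + (if R.nx z = d₂ then 1 else 0))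
    {h : G.Dart → ZMod 2} (hh : ∀ d, h (R.facePerm d) = h d) :
    ∑ d : G.Dart, a d * (h d + h d.symm) = h d₁ + h d₂ := by
  have h1 : ∑ d : G.Dart, a d * h d = ∑ d : G.Dart, a (R.nx d) * h (R.nx d) :=
    (Equiv.sum_comp R.nx fun d : G.Dart => a d * h d).symm
  have h2 : ∑ d : G.Dart, a d * h d.symm = ∑ d : G.Dart, a d * h (R.nx d) :=
    Finset.sum_congr rfl fun d _ => by rw [nx_eq_facePerm_symm, hh]
  simp only [mul_add, Finset.sum_add_distrib, h1, h2]
  rw [← Finset.sum_add_distrib]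
  simp only [← add_mul, ha]
  rw [Equiv.sum_comp R.nx fun d : G.Dart =>
    ((if d = d₁ then 1 else 0) + (if d = d₂ then 1 else 0) : ZMod 2) * h d]
  simp [add_mul, Finset.sum_add_distrib]

/-- On the sphere, a closed curve that passes through faces and through fewer than three vertices
does not separate a 3-connected graph. Here `a` marks the edges that leave these vertices to one
side of the curve. -/
theorem apply_eq_of_cocycle [Finite V] (h3 : G.IsThreeConnected) (hR : R.genus = 0)
    [Fintype G.Dart] {a : G.Dart → ZMod 2} {S : Set V} (hS : S.ncard < 3)
    (haS : ∀ d : G.Dart, d.fst ∉ S → a d = 0)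
    (ha : ∀ h : G.Dart → ZMod 2, (∀ d, h (R.facePerm d) = h d) →
      ∑ d : G.Dart, a d * (h d + h d.symm) = 0) {d d' : G.Dart} (hdd' : d.fst = d'.fst)
    (hd : d.snd ∉ S) (hd' : d'.snd ∉ S) : a d = a d' := by
  obtain ⟨g, hg⟩ := exists_vertex_potential h3.preconnected hR a ha
  have hc : g d.snd = g d'.snd := by
    refine eq_of_forall_adj_off (h3.2 S hS).preconnected (fun u v hu hv huv => ?_) hd hd'
    have h := hg ⟨(u, v), huv⟩
    rw [haS _ hu, haS _ (show (Dart.symm ⟨(u, v), huv⟩ : G.Dart).fst ∉ S from hv), add_zero] at h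
    exact CharTwo.add_eq_zero.1 h.symm
  have h1 := hg d
  have h2 := hg d'
  rw [haS d.symm hd, add_zero] at h1
  rw [haS d'.symm hd', add_zero] at h2
  rw [h1, h2, hdd', hc]

/-- A facial walk of a planar embedding of a 3-connected graph that passes through a vertex twice
would give a closed curve through this vertex only, with edges on both sides. -/
theorem eq_of_fst_eq_of_face_eq [Finite V] (h3 : G.IsThreeConnected) (hR : R.genus = 0)
    {d₁ d₂ : G.Dart} (hv : d₁.fst = d₂.fst) (hF : R.face d₁ = R.face d₂) : d₁ = d₂ := by
  classical
  have := Fintype.ofFinite G.Dart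
  by_contra hne
  obtain ⟨a, ha, hb⟩ := (R.sameCycle d₁ d₂ hv).exists_arc
  have hsupp : ∀ d : G.Dart, d.fst ∉ ({d₁.fst} : Set V) → a d = 0 := fun d hd => by
    by_contra h
    exact hd (fst_eq_of_sameCycle (ha d h))
  obtain ⟨z, hz⟩ := R.nx.surjective d₁
  have hzv : z.fst = d₁.fst := by rw [← R.fst_nx z, hz]
  have heq : a d₁ = a z := by
    refine apply_eq_of_cocycle h3 hR (by simp) hsupp (fun h hh => ?_) hzv.symm ?_ ?_
    · rw [sum_arc_mul hb hh, eq_of_face_eq hh hF, CharTwo.add_self_eq_zero]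
    · exact d₁.snd_ne_fst
    · exact fun h => z.snd_ne_fst (h.trans hzv.symm)
  have h1 := hb z
  rw [hz, heq, CharTwo.add_self_eq_zero] at h1
  simp [hne] at h1

/-- If two distinct faces of a planar embedding of a 3-connected graph share two vertices, then
the closed curve through these faces and vertices separates nothing but an edge between the two
vertices. -/
theorem exists_dart_of_common_vertices [Finite V] (h3 : G.IsThreeConnected) (hR : R.genus = 0)
    {d₁ d₂ e₁ e₂ : G.Dart} (hd : d₁.fst = d₂.fst) (he : e₁.fst = e₂.fst) (hne : d₁.fst ≠ e₁.fst)
    (h₁ : R.face d₁ = R.face e₁) (h₂ : R.face d₂ = R.face e₂) (hF : R.face d₁ ≠ R.face d₂) :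
    ∃ w : G.Dart, w.fst = d₁.fst ∧ w.snd = e₁.fst ∧
      (w = d₁ ∧ R.nx w = d₂ ∨ w = d₂ ∧ R.nx w = d₁) := by
  classical
  have := Fintype.ofFinite G.Dart
  have hdne : d₁ ≠ d₂ := fun h => hF (by rw [h])
  obtain ⟨a, ha, hb⟩ := (R.sameCycle d₁ d₂ hd).exists_arc
  obtain ⟨a', ha', hb'⟩ := (R.sameCycle e₁ e₂ he).exists_arc
  have hsupp : ∀ d : G.Dart, d.fst ≠ d₁.fst → a d = 0 := fun d hd => by
    by_contra h
    exact hd (fst_eq_of_sameCycle (ha d h))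
  have hsupp' : ∀ d : G.Dart, d.fst ≠ e₁.fst → a' d = 0 := fun d hd => by
    by_contra h
    exact hd (fst_eq_of_sameCycle (ha' d h))
  have key : ∀ d d' : G.Dart, d.fst = d₁.fst → d'.fst = d₁.fst → a d ≠ a d' →
      d.snd = e₁.fst ∨ d'.snd = e₁.fst := by
    intro d d' hdu hdu' had
    by_contra! hsnd
    have h := apply_eq_of_cocycle h3 hR (a := fun d => a d + a' d) (S := {d₁.fst, e₁.fst})
      (((Set.ncard_insert_le _ _).trans (by simp)).trans_lt Nat.le.refl)
      (fun d hd => ?_) (fun h hh => ?_)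
      (hdu.trans hdu'.symm) (d := d) (d' := d') ?_ ?_
    · simp only [hsupp' d (hdu ▸ hne), hsupp' d' (hdu' ▸ hne), add_zero] at h
      exact had h
    · simp only [Set.mem_insert_iff, Set.mem_singleton_iff, not_or] at hd
      simp only [hsupp d hd.1, hsupp' d hd.2, add_zero]
    · simp only [add_mul, Finset.sum_add_distrib]
      rw [sum_arc_mul hb hh, sum_arc_mul hb' hh, eq_of_face_eq hh h₁, eq_of_face_eq hh h₂,
        CharTwo.add_self_eq_zero]
    · simpa [hsnd.1] using fun h => d.snd_ne_fst (h.trans hdu.symm)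
    · simpa [hsnd.2] using fun h => d'.snd_ne_fst (h.trans hdu'.symm)
  obtain ⟨z₁, hz₁⟩ := R.nx.surjective d₁
  obtain ⟨z₂, hz₂⟩ := R.nx.surjective d₂
  have hzu₁ : z₁.fst = d₁.fst := by rw [← R.fst_nx z₁, hz₁]
  have hzu₂ : z₂.fst = d₁.fst := by rw [← R.fst_nx z₂, hz₂, hd]
  have k₁ := key d₁ z₁ rfl hzu₁ fun h => by
    have h1 := hb z₁
    rw [hz₁, h, CharTwo.add_self_eq_zero] at h1
    simp [hdne] at h1
  have k₂ := key d₂ z₂ hd.symm hzu₂ fun h => by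
    have h1 := hb z₂
    rw [hz₂, h, CharTwo.add_self_eq_zero] at h1
    simp [hdne.symm] at h1
  -- a directed edge is determined by its end points
  have huniq : ∀ d d' : G.Dart, d.fst = d₁.fst → d'.fst = d₁.fst → d.snd = e₁.fst →
      d'.snd = e₁.fst → d = d' := fun d d' p p' q q' =>
    Dart.ext _ _ (Prod.ext (p.trans p'.symm) (q.trans q'.symm))
  rcases k₁ with k₁ | k₁ <;> rcases k₂ with k₂ | k₂
  · exact absurd (huniq d₁ d₂ rfl hd.symm k₁ k₂) hdne
  · have h := huniq d₁ z₂ rfl hzu₂ k₁ k₂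
    exact ⟨d₁, rfl, k₁, Or.inl ⟨rfl, by rw [h, hz₂]⟩⟩
  · have h := huniq d₂ z₁ hd.symm hzu₁ k₂ k₁
    exact ⟨d₂, hd.symm, k₂, Or.inr ⟨rfl, by rw [h, hz₁]⟩⟩
  · have h := huniq z₁ z₂ hzu₁ hzu₂ k₁ k₂
    exact absurd (by rw [← hz₁, h, hz₂]) hdne

/-- Two distinct faces of a planar embedding of a 3-connected graph do not share three vertices:
otherwise, the first of these vertices would have only two edges. -/
theorem not_three_common_vertices [Finite V] (h3 : G.IsThreeConnected) (hR : R.genus = 0)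
    {d₁ d₂ e₁ e₂ f₁ f₂ : G.Dart} (hd : d₁.fst = d₂.fst) (he : e₁.fst = e₂.fst)
    (hf : f₁.fst = f₂.fst) (hde : d₁.fst ≠ e₁.fst) (hdf : d₁.fst ≠ f₁.fst)
    (hef : e₁.fst ≠ f₁.fst) (he₁ : R.face d₁ = R.face e₁) (he₂ : R.face d₂ = R.face e₂)
    (hf₁ : R.face d₁ = R.face f₁) (hf₂ : R.face d₂ = R.face f₂) :
    R.face d₁ = R.face d₂ := by
  by_contra hF
  obtain ⟨w, -, hw, h⟩ := exists_dart_of_common_vertices h3 hR hd he hde he₁ he₂ hF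
  obtain ⟨w', -, hw', h'⟩ := exists_dart_of_common_vertices h3 hR hd hf hdf hf₁ hf₂ hF
  have hww : w ≠ w' := fun h => hef (by rw [← hw, ← hw', h])
  rcases h with ⟨rfl, h⟩ | ⟨rfl, h⟩ <;> rcases h' with ⟨rfl, h'⟩ | ⟨rfl, h'⟩
  · exact hww rfl
  · exact R.nx_nx_ne h3 w (by rw [h, h'])
  · exact R.nx_nx_ne h3 w (by rw [h, h'])
  · exact hww rfl

theorem mem_verts_dartSubgraph_face {d : G.Dart} {v : V} :
    v ∈ (G.dartSubgraph (R.face d)).verts ↔ ∃ e ∈ R.face d, e.fst = v := by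
  constructor
  · rintro ⟨e, he, hv⟩
    rcases Sym2.mem_iff.1 (show v ∈ s(e.fst, e.snd) from hv) with rfl | rfl
    · exact ⟨e, he, rfl⟩
    · exact ⟨_, R.facePerm_mem_face he, R.fst_facePerm e⟩
  · rintro ⟨e, he, rfl⟩
    exact ⟨e, he, Sym2.mem_mk_left _ _⟩

/-- Planar embeddings of 3-connected graphs are polyhedral. -/
theorem isPolyhedral_of_genus_eq_zero [Finite V] (h3 : G.IsThreeConnected) (hR : R.genus = 0) :
    R.IsPolyhedral where
  vertex_simple := by
    rintro _ ⟨d, rfl⟩ e he e' he' h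
    exact eq_of_fst_eq_of_face_eq h3 hR h ((R.face_eq_of_mem he).trans (R.face_eq_of_mem he').symm)
  edge_simple := by
    rintro _ ⟨d, rfl⟩ e he e' he' h
    rcases (dart_edge_eq_iff e e').1 h with rfl | rfl
    · rfl
    · -- the successor of `e'.symm` on the face starts where `e'` does
      have h1 := R.facePerm_mem_face he
      refine absurd (eq_of_fst_eq_of_face_eq h3 hR (R.fst_facePerm e'.symm)
        ((R.face_eq_of_mem h1).trans (R.face_eq_of_mem he').symm)) ?_
      rw [facePerm_apply, Dart.symm_symm]
      exact R.nx_ne h3 e'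
  inter := by
    rintro _ ⟨d, rfl⟩ _ ⟨d', rfl⟩ hF
    set H := G.dartSubgraph (R.face d) ⊓ G.dartSubgraph (R.face d')
    have hverts : ∀ u ∈ H.verts, ∃ e e' : G.Dart, e.fst = u ∧ e'.fst = u ∧
        R.face e = R.face d ∧ R.face e' = R.face d' := by
      rintro u ⟨hu, hu'⟩
      obtain ⟨e, he, rfl⟩ := mem_verts_dartSubgraph_face.1 hu
      obtain ⟨e', he', h⟩ := mem_verts_dartSubgraph_face.1 hu'
      exact ⟨e, e', rfl, h, R.face_eq_of_mem he, R.face_eq_of_mem he'⟩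
    rcases Set.eq_empty_or_nonempty H.verts with h0 | ⟨u, hu⟩
    · exact Or.inl ((Subgraph.eq_bot_iff_verts_eq_empty _).2 h0)
    refine Or.inr ?_
    by_cases h1 : ∀ v ∈ H.verts, v = u
    · refine Or.inl ⟨u, Subgraph.ext (Set.ext fun v => ⟨h1 v, ?_⟩) ?_⟩
      · rintro rfl
        exact hu
      · ext x y
        refine ⟨fun hxy => absurd ?_ (H.adj_sub hxy).ne, fun hxy => hxy.elim⟩
        rw [h1 x hxy.fst_mem, h1 y hxy.snd_mem]
    refine Or.inr ?_
    push Not at h1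
    obtain ⟨v, hv, hvu⟩ := h1
    obtain ⟨d₁, d₂, rfl, hd, hd₁, hd₂⟩ := hverts u hu
    obtain ⟨e₁, e₂, rfl, he, he₁, he₂⟩ := hverts v hv
    obtain ⟨w, hw, hw', hww⟩ := exists_dart_of_common_vertices h3 hR hd.symm he.symm hvu.symm
      (hd₁.trans he₁.symm) (hd₂.trans he₂.symm) (by rwa [hd₁, hd₂])
    have hadj : G.Adj d₁.fst e₁.fst := by
      rw [← hw, ← hw']
      exact w.adj
    have hedge : w.edge = s(d₁.fst, e₁.fst) := by
      rw [← hw, ← hw']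
      rfl
    -- the edge of `w` lies between the corners of the two faces at its starting point
    have hHadj : H.Adj d₁.fst e₁.fst := by
      rcases hww with ⟨h1, h2⟩ | ⟨h1, h2⟩
      · refine ⟨⟨w, ?_, hedge⟩, ⟨w.symm, ?_, w.edge_symm.trans hedge⟩⟩
        · rw [← hd₁, h1]
          exact R.mem_face_self _
        · rw [← hd₂, ← h2, face_nx]
          exact R.mem_face_self _
      · refine ⟨⟨w.symm, ?_, w.edge_symm.trans hedge⟩, ⟨w, ?_, hedge⟩⟩
        · rw [← hd₁, ← h2, face_nx]
          exact R.mem_face_self _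
        · rw [← hd₂, h1]
          exact R.mem_face_self _
    have hV : H.verts = {d₁.fst, e₁.fst} := by
      refine Set.Subset.antisymm (fun x hx => ?_) ?_
      · obtain ⟨f₁, f₂, rfl, hf, hf₁, hf₂⟩ := hverts x hx
        by_contra hx
        simp only [Set.mem_insert_iff, Set.mem_singleton_iff, not_or] at hx
        refine hF ?_
        rw [← hd₁, ← hd₂]
        exact not_three_common_vertices h3 hR hd.symm he.symm hf.symm hvu.symm (Ne.symm hx.1)
          (Ne.symm hx.2) (hd₁.trans he₁.symm) (hd₂.trans he₂.symm) (hd₁.trans hf₁.symm)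
          (hd₂.trans hf₂.symm)
      · rintro x (rfl | rfl)
        exacts [hu, hv]
    refine ⟨_, _, hadj, Subgraph.ext hV ?_⟩
    ext x y
    simp only [subgraphOfAdj_adj]
    constructor
    · intro hxy
      have hx : x ∈ ({d₁.fst, e₁.fst} : Set V) := hV ▸ hxy.fst_mem
      have hy : y ∈ ({d₁.fst, e₁.fst} : Set V) := hV ▸ hxy.snd_mem
      have hne := (H.adj_sub hxy).ne
      rcases hx with rfl | rfl <;> rcases hy with rfl | rfl
      · exact absurd rfl hne
      · rfl
      · exact Sym2.eq_swap
      · exact absurd rfl hne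
    · intro hxy
      rcases Sym2.eq_iff.1 hxy with ⟨rfl, rfl⟩ | ⟨rfl, rfl⟩
      · exact hHadj
      · exact hHadj.symm

end RotationSystem

end SimpleGraph

/-! ### Polyhedral embeddings -/

namespace SimpleGraph

variable {V : Type*} {G : SimpleGraph V}

namespace RotationSystem

variable {R : G.RotationSystem}

namespace IsPolyhedral

theorem eq_of_fst_eq (hP : R.IsPolyhedral) {d e e' : G.Dart} (he : e ∈ R.face d)
    (he' : e' ∈ R.face d) (h : e.fst = e'.fst) : e = e' :=
  hP.vertex_simple _ ⟨d, rfl⟩ he he' h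

theorem symm_notMem_face (hP : R.IsPolyhedral) {d e : G.Dart} (he : e ∈ R.face d) :
    e.symm ∉ R.face d := fun h =>
  e.symm_ne (hP.edge_simple _ ⟨d, rfl⟩ h he e.edge_symm)

theorem inter_adj (hP : R.IsPolyhedral) {d d' : G.Dart} (hF : R.face d ≠ R.face d') {u v : V}
    (hu : u ∈ (G.dartSubgraph (R.face d)).verts) (hu' : u ∈ (G.dartSubgraph (R.face d')).verts)
    (hv : v ∈ (G.dartSubgraph (R.face d)).verts) (hv' : v ∈ (G.dartSubgraph (R.face d')).verts)
    (huv : u ≠ v) : (G.dartSubgraph (R.face d) ⊓ G.dartSubgraph (R.face d')).Adj u v := by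
  have hmu : u ∈ (G.dartSubgraph (R.face d) ⊓ G.dartSubgraph (R.face d')).verts := ⟨hu, hu'⟩
  have hmv : v ∈ (G.dartSubgraph (R.face d) ⊓ G.dartSubgraph (R.face d')).verts := ⟨hv, hv'⟩
  rcases hP.inter _ ⟨d, rfl⟩ _ ⟨d', rfl⟩ hF with h | ⟨w, h⟩ | ⟨x, y, hxy, h⟩
  · rw [h] at hmu
    exact hmu.elim
  · rw [h] at hmu hmv
    exact absurd (Eq.trans (show u = w from hmu) (show v = w from hmv).symm) huv
  · rw [h] at hmu hmv ⊢
    rw [subgraphOfAdj_adj]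
    rcases hmu with rfl | rfl <;> rcases hmv with rfl | rfl
    · exact absurd rfl huv
    · rfl
    · exact Sym2.eq_swap
    · exact absurd rfl huv

/-- The faces of a polyhedral embedding are induced cycles: a chord would lie on a second face. -/
theorem mem_or_symm_mem_face (hP : R.IsPolyhedral) {d x : G.Dart}
    (hx : x.fst ∈ (G.dartSubgraph (R.face d)).verts)
    (hx' : x.snd ∈ (G.dartSubgraph (R.face d)).verts) :
    x ∈ R.face d ∨ x.symm ∈ R.face d := by
  by_cases hF : R.face d = R.face x
  · exact Or.inl (hF ▸ R.mem_face_self x)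
  obtain ⟨e, he, hex⟩ := (hP.inter_adj hF hx (mem_verts_dartSubgraph_face.2
    ⟨x, R.mem_face_self x, rfl⟩) hx' (mem_verts_dartSubgraph_face.2
    ⟨_, R.facePerm_mem_face (R.mem_face_self x), R.fst_facePerm x⟩) x.fst_ne_snd).1
  rcases (dart_edge_eq_iff e x).1 hex with rfl | rfl
  exacts [Or.inl he, Or.inr he]

/-- The part of a face of a polyhedral embedding off another face is connected: it is what
remains of a cycle after the removal of at most two vertices, which are neighbours if
there are two. -/
theorem eq_of_mem_face_off [Finite V] (hP : R.IsPolyhedral) (d : G.Dart) {α : Type*} {g : V → α}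
    (hg : ∀ u v, u ∉ (G.dartSubgraph (R.face d)).verts → v ∉ (G.dartSubgraph (R.face d)).verts →
      G.Adj u v → g u = g v) {x y z : G.Dart} (hy : y ∈ R.face x) (hz : z ∈ R.face x)
    (hyC : y.fst ∉ (G.dartSubgraph (R.face d)).verts)
    (hzC : z.fst ∉ (G.dartSubgraph (R.face d)).verts) : g y.fst = g z.fst := by
  set C := (G.dartSubgraph (R.face d)).verts
  have hF : R.face x ≠ R.face d := fun h =>
    hyC (mem_verts_dartSubgraph_face.2 ⟨y, h ▸ hy, rfl⟩)
  -- The face leaves `C` at most once.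
  have hexit : ∀ e ∈ R.face x, ∀ e' ∈ R.face x, e.fst ∈ C → e'.fst ∈ C → e.snd ∉ C →
      e'.snd ∉ C → e = e' := by
    intro e he e' he' heC heC' hs hs'
    by_contra hne
    obtain ⟨w, hw, hwe⟩ := (hP.inter_adj hF (mem_verts_dartSubgraph_face.2 ⟨e, he, rfl⟩) heC
      (mem_verts_dartSubgraph_face.2 ⟨e', he', rfl⟩) heC'
      fun h => hne (hP.eq_of_fst_eq he he' h)).1
    rcases Sym2.eq_iff.1 (show s(w.fst, w.snd) = _ from hwe) with ⟨h1, h2⟩ | ⟨h1, h2⟩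
    · rw [hP.eq_of_fst_eq hw he h1] at h2
      exact hs (h2 ▸ heC')
    · rw [hP.eq_of_fst_eq hw he' h1] at h2
      exact hs' (h2 ▸ heC)
  -- Hence all vertices off `C` are reached from where the face leaves `C`.
  have hwalk : ∀ b ∈ R.face x, (∀ e ∈ R.face x, e.fst ∈ C → e.snd ∉ C → R.facePerm e = b) →
      ∀ e ∈ R.face x, e.fst ∉ C → g e.fst = g b.fst := by
    intro b hb hexit e he
    have hbe : R.facePerm.SameCycle b e := (Equiv.Perm.SameCycle.symm hb).trans he
    refine hbe.forward_induction (p := fun e => e.fst ∉ C → g e.fst = g b.fst) (fun _ => rfl) ?_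
    intro e hbe ih heC
    have hex : e ∈ R.face x := Equiv.Perm.SameCycle.trans hb hbe
    by_cases hC' : e.fst ∈ C
    · rw [hexit e hex hC' (R.fst_facePerm e ▸ heC)]
    · rw [← ih hC', R.fst_facePerm]
      rw [R.fst_facePerm] at heC
      exact (hg _ _ hC' heC e.adj).symm
  by_cases h : ∃ e ∈ R.face x, e.fst ∈ C ∧ e.snd ∉ C
  · obtain ⟨b, hb, hbC, hbC'⟩ := h
    have hw := hwalk _ (R.facePerm_mem_face hb) fun e he h1 h2 => by
      rw [hexit e he b hb h1 hbC h2 hbC']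
    rw [hw y hy hyC, hw z hz hzC]
  · exact (hwalk y hy (fun e he h1 h2 => absurd ⟨e, he, h1, h2⟩ h) z hz hzC).symm

/-- The faces of a polyhedral embedding do not separate the graph. Going around a face `F`, the
successive other faces that meet `F` share edges, and each of them is connected off `F`. -/
theorem eq_of_forall_adj_off_face [Finite V] (hP : R.IsPolyhedral) (h3 : G.IsThreeConnected)
    (d : G.Dart) {α : Type*} {g : V → α}
    (hg : ∀ u v, u ∉ (G.dartSubgraph (R.face d)).verts → v ∉ (G.dartSubgraph (R.face d)).verts →
      G.Adj u v → g u = g v) {u v : V} (hu : u ∉ (G.dartSubgraph (R.face d)).verts)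
    (hv : v ∉ (G.dartSubgraph (R.face d)).verts) : g u = g v := by
  classical
  set C := (G.dartSubgraph (R.face d)).verts
  -- `p x`: the part of the face at `x` off `C` carries the value `g u`
  let p : G.Dart → Prop := fun x => ∃ e ∈ R.face x, e.fst ∉ C ∧ g e.fst = g u
  have hpface : ∀ x, p (R.facePerm x) = p x := fun x => by simp only [p, R.face_facePerm]
  have hpoff : ∀ x : G.Dart, x.fst ∉ C → p x = (g x.fst = g u) := fun x hx =>
    propext ⟨fun ⟨e, he, heC, h⟩ =>
      (hP.eq_of_mem_face_off d hg (R.mem_face_self x) he hx heC).trans h,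
      fun h => ⟨x, R.mem_face_self x, hx, h⟩⟩
  have hpoff' : ∀ x : G.Dart, x.fst ∉ C → p x.symm = p x := fun x hx => by
    have hf : (R.facePerm x.symm).fst = x.fst := R.fst_facePerm _
    rw [← hpface, hpoff x hx, hpoff _ (by rwa [hf]), hf]
  have hmem : ∀ x ∈ R.face d, x.fst ∈ C := fun x hx => mem_verts_dartSubgraph_face.2 ⟨x, hx, rfl⟩
  -- The face itself is skipped by giving its side of an edge the value of the other side.
  let q : G.Dart → Prop := fun x => if x ∈ R.face d then p x.symm else p x
  have hqsymm : ∀ x, q x.symm = q x := by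
    intro x
    by_cases hx : x ∈ R.face d
    · simp only [q, hx, hP.symm_notMem_face hx, if_true, if_false]
    by_cases hx' : x.symm ∈ R.face d
    · simp only [q, hx, hx', if_true, if_false, Dart.symm_symm]
    simp only [q, hx, hx', if_false]
    by_cases hxC : x.fst ∈ C
    · have hxC' : x.snd ∉ C := fun h => (hP.mem_or_symm_mem_face hxC h).elim hx hx'
      have h := hpoff' x.symm hxC'
      rw [Dart.symm_symm] at h
      exact h.symm
    · exact hpoff' x hxC
  have hqnx : ∀ x : G.Dart, x.symm ∉ R.face d → q (R.nx x) = q x := by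
    intro x hx
    have hx' : R.facePerm x.symm ∉ R.face d := fun h => hx (R.facePerm_mem_face_iff.1 h)
    rw [← hqsymm x, nx_eq_facePerm_symm]
    simp only [q, hx, hx', if_false, hpface]
  have hqnx' : ∀ x : G.Dart, q (R.nx x) = q x := by
    intro x
    by_cases hx : x.symm ∈ R.face d
    · refine R.nx.apply_eq_of_forall_ne q x fun z hz hzx => hqnx z fun hzd => hzx ?_
      have h := hP.eq_of_fst_eq (R.facePerm_mem_face hzd) (R.facePerm_mem_face hx)
        (by rw [R.fst_facePerm, R.fst_facePerm]; exact fst_eq_of_sameCycle hz)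
      exact Dart.symm_involutive.injective (R.facePerm.injective h)
    · exact hqnx x hx
  obtain ⟨u', hu', -⟩ := h3.exists_adj_ne u u u
  obtain ⟨v', hv', -⟩ := h3.exists_adj_ne v v v
  have hqoff : ∀ x : G.Dart, x.fst ∉ C → q x = (g x.fst = g u) := fun x hx => by
    have hx' : x ∉ R.face d := fun h => hx (hmem x h)
    simp only [q, hx', if_false, hpoff x hx]
  have h := eq_of_invariant h3.preconnected hqnx' hqsymm ⟨(u, u'), hu'⟩ ⟨(v, v'), hv'⟩
  rw [hqoff _ hu, hqoff _ hv] at h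
  exact (h.mp rfl).symm

end IsPolyhedral

/-- A face of a polyhedral embedding is also a face of every planar embedding, up to orientation.
As a cycle, it is the boundary of a chain of faces of the planar embedding. Since it is induced and
does not separate the graph, all faces on one side of it run along the cycle, so there is only one
face on this side. -/
theorem face_agrees_or_opposes [Finite V] (h3 : G.IsThreeConnected) (hR : R.genus = 0)
    {R' : G.RotationSystem} (hP : R'.IsPolyhedral) (d : G.Dart) :
    (∀ e ∈ R'.face d, R.nx e.symm = R'.nx e.symm) ∨
      ∀ e ∈ R'.face d, R.nx (R'.nx e.symm) = e.symm := by
  classical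
  have := Fintype.ofFinite G.Dart
  set C := (G.dartSubgraph (R'.face d)).verts
  have hmem : ∀ x ∈ R'.face d, x.fst ∈ C := fun x hx => mem_verts_dartSubgraph_face.2 ⟨x, hx, rfl⟩
  have hmem' : ∀ x ∈ R'.face d, x.snd ∈ C := fun x hx =>
    mem_verts_dartSubgraph_face.2 ⟨_, R'.facePerm_mem_face hx, R'.fst_facePerm x⟩
  obtain ⟨h, hface, hjump⟩ := exists_face_potential h3.preconnected hR
    (fun x => if x ∈ R'.face d then 1 else 0) fun g => by
      have h1 : ∑ x : G.Dart, (if x ∈ R'.face d then (1 : ZMod 2) else 0) * g x.snd =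
          ∑ x : G.Dart, (if x ∈ R'.face d then (1 : ZMod 2) else 0) * g x.fst := by
        rw [← Equiv.sum_comp R'.facePerm fun x : G.Dart =>
          (if x ∈ R'.face d then (1 : ZMod 2) else 0) * g x.fst]
        simp only [R'.facePerm_mem_face_iff, R'.fst_facePerm]
      simp only [mul_add, Finset.sum_add_distrib, h1, CharTwo.add_self_eq_zero]
  have hoff : ∀ x : G.Dart, x ∉ R'.face d → x.symm ∉ R'.face d → h x = h x.symm := by
    intro x hx hx'
    have h1 := hjump x
    simp only [hx, hx', if_false, add_zero] at h1
    exact CharTwo.add_eq_zero.1 h1.symm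
  have hon : ∀ x ∈ R'.face d, h x ≠ h x.symm := by
    intro x hx heq
    have h1 := hjump x
    simp only [hx, hP.symm_notMem_face hx, if_true, if_false, heq, CharTwo.add_self_eq_zero] at h1
    simp at h1
  have hnx : ∀ x : G.Dart, h (R.nx x) = h x.symm := fun x => by rw [nx_eq_facePerm_symm, hface]
  -- `h` has a single value at all vertices off `C`
  have hvertex : ∀ x y : G.Dart, x.fst ∉ C → x.fst = y.fst → h x = h y := by
    intro x y hx hxy
    refine (R.sameCycle x y hxy).forward_induction (p := fun z => h x = h z) rfl fun z hz hxz => ?_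
    have hzC : z.fst ∉ C := by rwa [fst_eq_of_sameCycle hz]
    rw [hnx, ← hoff z (fun h => hzC (hmem z h)) (fun h => hzC (hmem' _ h)), hxz]
  obtain ⟨c, hc⟩ : ∃ c, ∀ x : G.Dart, x.fst ∉ C → h x = c := by
    choose nb hnb _ using fun v => h3.exists_adj_ne v v v
    let g : V → ZMod 2 := fun v => h ⟨(v, nb v), hnb v⟩
    have hg : ∀ u v, u ∉ C → v ∉ C → G.Adj u v → g u = g v := by
      intro u v hu hv huv
      have h1 : g u = h ⟨(u, v), huv⟩ := hvertex _ _ hu rfl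
      have h2 : g v = h (Dart.symm ⟨(u, v), huv⟩) := hvertex _ _ hv rfl
      rw [h1, h2]
      exact hoff _ (fun h => hu (hmem _ h)) (fun h => hv (hmem _ h))
    by_cases hne : ∃ u, u ∉ C
    · obtain ⟨u, hu⟩ := hne
      exact ⟨g u, fun x hx => (hvertex x ⟨(x.fst, nb x.fst), hnb _⟩ hx rfl).trans
        (hP.eq_of_forall_adj_off_face h3 d hg hx hu)⟩
    · exact ⟨0, fun x hx => absurd ⟨_, hx⟩ hne⟩
  -- so the faces on the other side run along the cycle
  have halong : ∀ x : G.Dart, h x ≠ c → x ∈ R'.face d ∨ x.symm ∈ R'.face d := by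
    intro x hx
    have h1 : x.fst ∈ C := by_contra fun h' => hx (hc x h')
    have h2 : x.snd ∈ C := by_contra fun h' => hx <| by
      rw [← hface x]
      exact hc _ (by rwa [R.fst_facePerm])
    exact hP.mem_or_symm_mem_face h1 h2
  by_cases hd : h d ≠ c
  · left
    have hstep : ∀ e ∈ R'.face d, h e ≠ c → R.facePerm e = R'.facePerm e := by
      intro e he hec
      rcases halong (R.facePerm e) (by rwa [hface]) with hm | hm
      · exact hP.eq_of_fst_eq hm (R'.facePerm_mem_face he)
          ((R.fst_facePerm e).trans (R'.fst_facePerm e).symm)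
      · have h1 : R'.facePerm (R.facePerm e).symm = R'.facePerm e :=
          hP.eq_of_fst_eq (R'.facePerm_mem_face hm) (R'.facePerm_mem_face he)
            ((R'.fst_facePerm _).trans ((R.fst_facePerm e).trans (R'.fst_facePerm e).symm))
        refine absurd ?_ (hon e he)
        rw [← R'.facePerm.injective h1, Dart.symm_symm, R'.facePerm.injective h1, hface]
    have hall : ∀ e ∈ R'.face d, h e ≠ c := fun e he =>
      Equiv.Perm.SameCycle.forward_induction he (p := fun e => h e ≠ c) hd fun e he hec => by
        rwa [← hstep e he hec, hface]
    exact fun e he => hstep e he (hall e he)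
  · right
    have hd' : h d.symm ≠ c := fun h' => hon d (R'.mem_face_self d) (by rw [h', not_not.1 hd])
    have hstep : ∀ e ∈ R'.face d, h e.symm ≠ c → R'.facePerm (R.nx e).symm = e := by
      intro e he hec
      rcases halong (R.nx e) (by rwa [hnx]) with hm | hm
      · exact absurd (hP.eq_of_fst_eq hm he (R.fst_nx e)) (R.nx_ne h3 e)
      · exact hP.eq_of_fst_eq (R'.facePerm_mem_face hm) he
          ((R'.fst_facePerm _).trans (R.fst_nx e))
    -- the planar embedding traverses the cycle backwards
    have hall : ∀ e ∈ R'.face d, h e.symm ≠ c := fun e he =>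
      (Equiv.Perm.SameCycle.inv he).forward_induction (p := fun e => h e.symm ≠ c) hd'
        fun e he hec => by
          have h1 := hstep e (Equiv.Perm.sameCycle_inv.1 he) hec
          have h2 : R'.facePerm⁻¹ e = (R.nx e).symm := Equiv.Perm.inv_eq_iff_eq.2 h1.symm
          rwa [h2, Dart.symm_symm, hnx]
    intro e he
    have hm := R'.facePerm_mem_face he
    have h1 := R'.facePerm.injective (hstep _ hm (hall _ hm))
    rw [facePerm_apply] at h1
    exact Dart.symm_involutive.eq_iff.1 h1

/-- A polyhedral embedding agrees with a planar one or with its mirror image. At consecutive edges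
of a rotation both orientations cannot occur, because each vertex has more than two edges. -/
theorem IsPolyhedral.equivalent [Finite V] (h3 : G.IsThreeConnected) (hR : R.genus = 0)
    {R' : G.RotationSystem} (hP : R'.IsPolyhedral) : R.Equivalent R' := by
  let P : G.Dart → Prop := fun x => R.nx x = R'.nx x
  have hexcl : ∀ x, P x → R.nx (R'.nx x) ≠ x := fun x hx h =>
    R.nx_nx_ne h3 x (by rw [show R.nx x = R'.nx x from hx, h])
  have hcases : ∀ x, ¬ P x → R.nx (R'.nx x) = x := fun x hx => by
    have hm := R'.mem_face_self x.symm
    rcases face_agrees_or_opposes h3 hR hP x.symm with h | h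
    · exact absurd (h _ hm) hx
    · exact h _ hm
  have hnx : ∀ x, P (R'.nx x) = P x := by
    refine fun x => propext ⟨fun h => by_contra fun hx => ?_, fun hx => by_contra fun h => ?_⟩
    · exact R'.nx_nx_ne h3 x ((show R.nx (R'.nx x) = _ from h).symm.trans (hcases x hx))
    · have h1 := (hcases _ h).trans (show R.nx x = R'.nx x from hx).symm
      exact R'.nx_nx_ne h3 x (R.nx.injective h1)
  have hface : ∀ x, P (R'.nx x).symm = P x := by
    intro x
    have hm := R'.mem_face_self x.symm
    have hm' : R'.nx x ∈ R'.face x.symm := by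
      rw [nx_eq_facePerm_symm]
      exact R'.facePerm_mem_face hm
    rcases face_agrees_or_opposes h3 hR hP x.symm with h | h
    · exact propext ⟨fun _ => h _ hm, fun _ => h _ hm'⟩
    · exact propext ⟨fun hx => absurd (h _ hm') (hexcl _ hx),
        fun hx => absurd (h _ hm) (hexcl _ hx)⟩
  have hsymm : ∀ x, P x.symm = P x := by
    intro x
    obtain ⟨y, rfl⟩ := R'.nx.surjective x
    rw [hface, hnx]
  by_cases hall : ∀ x, P x
  · exact Or.inl (RotationSystem.ext (Equiv.ext fun x => (hall x).symm))
  · push Not at hall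
    obtain ⟨y, hy⟩ := hall
    refine Or.inr (RotationSystem.ext (Equiv.ext fun x => Equiv.Perm.eq_inv_iff_eq.2 ?_))
    exact hcases x fun hx => hy ((eq_of_invariant h3.preconnected hnx hsymm x y).mp hx)

end RotationSystem

end SimpleGraph

theorem theorem1 {V : Type*} [Finite V] (G : SimpleGraph V)
    (hconn : G.IsThreeConnected) (hplanar : G.IsPlanar) :
    ∃ R : G.RotationSystem, R.IsPolyhedral ∧
      ∀ R' : G.RotationSystem, R'.IsPolyhedral → R.Equivalent R' := by
  obtain ⟨R, hR⟩ := hplanar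
  exact ⟨R, SimpleGraph.RotationSystem.isPolyhedral_of_genus_eq_zero hconn hR,
    fun _ hR' => hR'.equivalent hconn hR⟩
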